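/- All systems are finite-dimensional, with fixed orthonormal bases. Let $\mathcal{N}_{A\to B}$ be a quantum channel. Put $\mathrm{PPT}'(A{:}B)=\{\sigma_{AB}\ge 0:\|T_B(\sigma_{AB})\|_1\le 1\}$, where $T_B$ is the partial transpose; $D_{\max}(\rho\|\sigma)=\inf\{\lambda\in\mathbb{R}:\rho\le 2^{\lambda}\sigma\}$ (equal to $\infty$ if there is no such $\lambda$); $R_{\max}(A;B)_\rho=\min_{\sigma\in \mathrm{PPT}'(A:B)}D_{\max}(\rho\|\sigma)$; and $$R_{\max}(\mathcal{N})=\max_{\phi_{SA}}R_{\max}(S;B)_{(\mathrm{id}_S\otimes\mathcal{N})(\phi_{SA})},$$ the maximum being over pure states $\phi_{SA}$ with $|S|=|A|$. A channel $\mathcal{P}_{AB\to A'B'}$ is PPT-preserving (PPT-P) if $T_{B'}\circ\mathcal{P}\circ T_B$ is also a quantum channel. An LOCC channel is a finite composition of channels of the form $\sum_x\mathcal{F}^x_{A\to A'}\otimes\mathcal{G}^x_{B\to B'}$, where the maps of one party are completely positive and sum to a channel, and those of the other party are all channels. For either class of free channels, an $(n,M,\varepsilon)$ protocol consists of $n\ge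 1$ uses of $\mathcal{N}$ and $n+1$ free channels as follows. A free channel with trivial input creates a state of $A_1'A_1{:}B_1'$. Then, for $i=1,\dots,n$, Alice sends $A_i$ through $\mathcal{N}_{A_i\to B_i}$, and a free channel is applied to $A_i'{:}B_iB_i'$, with output $A_{i+1}'A_{i+1}{:}B_{i+1}'$ if $i<n$ and $M_A{:}M_B$ if $i=n$. Here $A_i'$ and $B_i'$ have arbitrary finite dimension, $|M_A|=|M_B|=M$, and the final state $\omega$ has to satisfy $\langle\Phi|\omega|\Phi\rangle\ge1-\varepsilon$ with $|\Phi\rangle=M^{-1/2}\sum_{m=1}^{M}|m\rangle|m\rangle$. A real number $R$ is an achievable rate if for all $\varepsilon\in(0,1]$, $\delta>0$ and all sufficiently large $n$ there is an $(n,M,\varepsilon)$ protocol with $M\ge2^{n(R-\delta)}$; it is a strong converse rate if for all $\varepsilon\in[0,1)$, $\delta>0$ and all sufficiently large $n$ there is no $(n,M,\varepsilon)$ protocol with $M\ge2^{n(R+\delta)}$. The capacity is the supremum of the achievable rates, and the strong converse capacity is the infimum of the strong converse rates. Denote them by $Q^{\mathrm{PPT\text{-}P},\leftrightarrow}$ and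 $Q^{\mathrm{PPT\text{-}P},\leftrightarrow\dagger}$ for PPT-P assistance and by $Q^{\leftrightarrow}$ and $Q^{\leftrightarrow\dagger}$ for LOCC assistance. **Corollary.** For every quantum channel $\mathcal{N}_{A\to B}$, $$Q^{\mathrm{PPT\text{-}P},\leftrightarrow\dagger}(\mathcal{N})\le R_{\max}(\mathcal{N}).$$ Consequently, also $Q^{\leftrightarrow\dagger}(\mathcal{N})\le R_{\max}(\mathcal{N})$ and $Q^{\leftrightarrow}(\mathcal{N})\le R_{\max}(\mathcal{N})$. -/

import Mathlib

open scoped ComplexOrder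

noncomputable section

/-! A finite-dimensional quantum system with a fixed orthonormal basis is represented by the finite
type indexing the basis; composite systems are products of index types. -/

/-- Linear operators on the Hilbert space with orthonormal basis indexed by `A`. -/
abbrev Op (A : Type) : Type := Matrix A A ℂ

/-- Linear maps from operators on `A` to operators on `B`. -/
abbrev Superop (A B : Type) : Type := Op A →ₗ[ℂ] Op B

/-- The map `id_R ⊗ Φ`, for `Φ` from `A` to `B`. -/
def idTensor (R : Type) {A B : Type} (Φ : Superop A B) : Superop (R × A) (R × B) where
  toFun X := Matrix.of fun p q => Φ (Matrix.of fun a a' => X (p.1, a) (q.1, a')) p.2 q.2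
  map_add' X Y := by
    ext p q
    exact congrFun (congrFun (Φ.map_add (Matrix.of fun a a' => X (p.1, a) (q.1, a'))
      (Matrix.of fun a a' => Y (p.1, a) (q.1, a'))) p.2) q.2
  map_smul' c X := by
    ext p q
    exact congrFun (congrFun (Φ.map_smul c (Matrix.of fun a a' => X (p.1, a) (q.1, a'))) p.2) q.2

/-- The map `Φ ⊗ id_R`, for `Φ` from `A` to `B`. -/
def tensorId (R : Type) {A B : Type} (Φ : Superop A B) : Superop (A × R) (B × R) where
  toFun X := Matrix.of fun p q => Φ (Matrix.of fun a a' => X (a, p.2) (a', q.2)) p.1 q.1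
  map_add' X Y := by
    ext p q
    exact congrFun (congrFun (Φ.map_add (Matrix.of fun a a' => X (a, p.2) (a', q.2))
      (Matrix.of fun a a' => Y (a, p.2) (a', q.2))) p.1) q.1
  map_smul' c X := by
    ext p q
    exact congrFun (congrFun (Φ.map_smul c (Matrix.of fun a a' => X (a, p.2) (a', q.2))) p.1) q.1

/-- The map `F ⊗ G`, for `F` from `A` to `A'` and `G` from `B` to `B'`. -/
def tensorMap {A B A' B' : Type} (F : Superop A A') (G : Superop B B') :
    Superop (A × B) (A' × B') :=
  tensorId B' F ∘ₗ idTensor A G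

/-- The map `Φ` is completely positive: `id_k ⊗ Φ` preserves positive semidefiniteness for all
`k`. -/
def IsCompletelyPositive {A B : Type} (Φ : Superop A B) : Prop :=
  ∀ (k : ℕ) (X : Op (Fin k × A)), X.PosSemidef → (idTensor (Fin k) Φ X).PosSemidef

/-- A quantum channel is a completely positive, trace-preserving linear map. -/
def IsChannel {A B : Type} [Fintype A] [Fintype B] (Φ : Superop A B) : Prop :=
  IsCompletelyPositive Φ ∧ ∀ X : Op A, (Φ X).trace = X.trace

/-- The partial transpose `T_B` on operators on `A ⊗ B`. -/
def partialTranspose (A B : Type) : Superop (A × B) (A × B) where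
  toFun X := Matrix.of fun p q => X (p.1, q.2) (q.1, p.2)
  map_add' _ _ := rfl
  map_smul' _ _ := rfl

open scoped MatrixOrder in
/-- The trace norm `‖X‖₁ = Tr |X|`, with `|X| = √(X† X)`. -/
def traceNorm {A : Type} [Fintype A] [DecidableEq A] (X : Op A) : ℝ :=
  (CFC.abs X).trace.re

/-- The set `PPT'(A : B)` of operators `σ ≥ 0` with `‖T_B σ‖₁ ≤ 1`. -/
def PPTPrime (A B : Type) [Fintype A] [Fintype B] [DecidableEq A] [DecidableEq B] :
    Set (Op (A × B)) :=
  {σ | σ.PosSemidef ∧ traceNorm (partialTranspose A B σ) ≤ 1}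

/-- The max-relative entropy `D_max(ρ‖σ) = inf {t : ρ ≤ 2 ^ t σ}`, which is `∞` if there is no such
real number `t`. -/
def maxRelEntropy {A : Type} (ρ σ : Op A) : EReal :=
  ⨅ (t : ℝ) (_ : (((2 : ℝ) ^ t) • σ - ρ).PosSemidef), (t : EReal)

/-- The max-Rains relative entropy `R_max(A ; B)_ρ`. -/
def maxRainsRelEntropy {A B : Type} [Fintype A] [Fintype B] [DecidableEq A] [DecidableEq B]
    (ρ : Op (A × B)) : EReal :=
  ⨅ σ ∈ PPTPrime A B, maxRelEntropy ρ σ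

/-- The max-Rains information `R_max(𝒩)` of a channel from `A` to `B`: the supremum of
`R_max(S ; B)` of `(id_S ⊗ 𝒩)(|φ⟩⟨φ|)` over unit vectors `φ` of `S ⊗ A`, where `S` is a copy
of `A`. -/
def maxRainsInformation {A B : Type} [Fintype A] [Fintype B] [DecidableEq A] [DecidableEq B]
    (N : Superop A B) : EReal :=
  ⨆ (φ : A × A → ℂ) (_ : star φ ⬝ᵥ φ = 1),
    maxRainsRelEntropy (idTensor A N (Matrix.vecMulVec φ (star φ)))

/-- A PPT-preserving channel from `AB` to `A'B'` (Alice holds `A` and `A'`, Bob holds `B` and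
`B'`): a channel `P` such that `T_{B'} ∘ P ∘ T_B` is a channel too. -/
def IsPPTPreserving (A B A' B' : Type) [Fintype A] [Fintype B] [Fintype A'] [Fintype B']
    (P : Superop (A × B) (A' × B')) : Prop :=
  IsChannel P ∧ IsChannel (partialTranspose A' B' ∘ₗ P ∘ₗ partialTranspose A B)

/-- LOCC channels from `AB` to `A'B'`: finite compositions of channels `∑ x, F x ⊗ G x`, where one
party applies an instrument, sends its classical outcome `x` to the other party, and that party
applies a channel depending on `x`. -/
inductive IsLOCC : ∀ (A B A' B' : Type) [Fintype A] [Fintype B] [Fintype A'] [Fintype B'],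
    Superop (A × B) (A' × B') → Prop
  | aliceToBob {A B A' B' : Type} [Fintype A] [Fintype B] [Fintype A'] [Fintype B']
      (m : ℕ) (F : Fin m → Superop A A') (G : Fin m → Superop B B')
      (hF : ∀ x, IsCompletelyPositive (F x)) (hFsum : IsChannel (∑ x, F x))
      (hG : ∀ x, IsChannel (G x)) :
      IsLOCC A B A' B' (∑ x, tensorMap (F x) (G x))
  | bobToAlice {A B A' B' : Type} [Fintype A] [Fintype B] [Fintype A'] [Fintype B']
      (m : ℕ) (F : Fin m → Superop A A') (G : Fin m → Superop B B')
      (hF : ∀ x, IsChannel (F x))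
      (hG : ∀ x, IsCompletelyPositive (G x)) (hGsum : IsChannel (∑ x, G x)) :
      IsLOCC A B A' B' (∑ x, tensorMap (F x) (G x))
  | comp {A B C D A' B' : Type} [Fintype A] [Fintype B] [Fintype C] [Fintype D]
      [Fintype A'] [Fintype B'] (P : Superop (A × B) (C × D)) (Q : Superop (C × D) (A' × B'))
      (hP : IsLOCC A B C D P) (hQ : IsLOCC C D A' B' Q) :
      IsLOCC A B A' B' (Q ∘ₗ P)

/-- A class of bipartite maps that may be used as free assistance. -/
abbrev FreeClass : Type 1 :=
  ∀ (A B A' B' : Type) [Fintype A] [Fintype B] [Fintype A'] [Fintype B'],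
    Superop (A × B) (A' × B') → Prop

/-- Alice sends the system `A` through the channel `N`: an operator on `A'A : B'` is taken to an
operator on `A' : BB'`. -/
def useChannel {A B : Type} (N : Superop A B) (A' B' : Type) (ρ : Op ((A' × A) × B')) :
    Op (A' × (B × B')) :=
  idTensor A' (tensorId B' N) (ρ.submatrix (fun p => ((p.1, p.2.1), p.2.2))
    (fun p => ((p.1, p.2.1), p.2.2)))

/-- `IsProtocolState free N n a b σ`: some protocol assisted by channels from `free` prepares the
operator `σ` on `A'_n : B_n B'_n` right after its `n`-th use of the channel `N`, where
`a = dim A'_n` and `b = dim B'_n`. The first free channel acts on trivial (one-dimensional)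
systems, and every later one acts between two successive channel uses. -/
inductive IsProtocolState (free : FreeClass) {A B : Type} [Fintype A] [Fintype B]
    (N : Superop A B) :
    ℕ → ∀ a b : ℕ, Op (Fin a × (B × Fin b)) → Prop
  | first (a b : ℕ) (P : Superop (Unit × Unit) ((Fin a × A) × Fin b))
      (hP : free Unit Unit (Fin a × A) (Fin b) P) :
      IsProtocolState free N 1 a b (useChannel N (Fin a) (Fin b) (P 1))
  | next (n a b a' b' : ℕ) (σ : Op (Fin a × (B × Fin b)))
      (hσ : IsProtocolState free N n a b σ)
      (P : Superop (Fin a × (B × Fin b)) ((Fin a' × A) × Fin b'))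
      (hP : free (Fin a) (B × Fin b) (Fin a' × A) (Fin b') P) :
      IsProtocolState free N (n + 1) a' b' (useChannel N (Fin a') (Fin b') (P σ))

/-- The maximally entangled vector `|Φ⟩ = M ^ (-1/2) ∑ m, |m⟩ ⊗ |m⟩`. -/
def maxEntangled (M : ℕ) : Fin M × Fin M → ℂ :=
  fun p => if p.1 = p.2 then ((1 / Real.sqrt M : ℝ) : ℂ) else 0

/-- There is an `(n, M, ε)` protocol, assisted by channels from `free`, over the channel `N`: it
uses `N` `n` times and a final free channel produces a state `ω` on `M_A : M_B`, with
`|M_A| = |M_B| = M`, such that `⟨Φ|ω|Φ⟩ ≥ 1 - ε`. -/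
def HasProtocol (free : FreeClass) {A B : Type} [Fintype A] [Fintype B] (N : Superop A B)
    (n M : ℕ) (ε : ℝ) : Prop :=
  ∃ (a b : ℕ) (σ : Op (Fin a × (B × Fin b)))
    (P : Superop (Fin a × (B × Fin b)) (Fin M × Fin M)),
    IsProtocolState free N n a b σ ∧ free (Fin a) (B × Fin b) (Fin M) (Fin M) P ∧
      1 - ε ≤ (star (maxEntangled M) ⬝ᵥ ((P σ).mulVec (maxEntangled M))).re

/-- The rate `R` is achievable: for all `ε ∈ (0, 1]`, `δ > 0` and large `n`, some `(n, M, ε)`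
protocol has `M ≥ 2 ^ (n (R - δ))`. -/
def IsAchievableRate (free : FreeClass) {A B : Type} [Fintype A] [Fintype B]
    (N : Superop A B) (R : ℝ) : Prop :=
  ∀ ε ∈ Set.Ioc (0 : ℝ) 1, ∀ δ > (0 : ℝ), ∀ᶠ n : ℕ in Filter.atTop,
    ∃ M : ℕ, (2 : ℝ) ^ ((n : ℝ) * (R - δ)) ≤ M ∧ HasProtocol free N n M ε

/-- The rate `R` is a strong converse rate: for all `ε ∈ [0, 1)`, `δ > 0` and large `n`, no
`(n, M, ε)` protocol has `M ≥ 2 ^ (n (R + δ))`. -/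
def IsStrongConverseRate (free : FreeClass) {A B : Type} [Fintype A] [Fintype B]
    (N : Superop A B) (R : ℝ) : Prop :=
  ∀ ε ∈ Set.Ico (0 : ℝ) 1, ∀ δ > (0 : ℝ), ∀ᶠ n : ℕ in Filter.atTop,
    ¬ ∃ M : ℕ, (2 : ℝ) ^ ((n : ℝ) * (R + δ)) ≤ M ∧ HasProtocol free N n M ε

/-- The quantum capacity of `N` assisted by channels from `free`: the supremum of all achievable
rates. -/
def assistedCapacity (free : FreeClass) {A B : Type} [Fintype A] [Fintype B]
    (N : Superop A B) : EReal :=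
  ⨆ (R : ℝ) (_ : IsAchievableRate free N R), (R : EReal)

/-- The strong converse quantum capacity of `N` assisted by channels from `free`: the infimum of
all strong converse rates. -/
def strongConverseCapacity (free : FreeClass) {A B : Type} [Fintype A] [Fintype B]
    (N : Superop A B) : EReal :=
  ⨅ (R : ℝ) (_ : IsStrongConverseRate free N R), (R : EReal)

end

/-! Up to taking logarithms, the max-Rains relative entropy is a semidefinite programme: minimise
`Tr (P + Q)` over `P, Q ≥ 0` with `T_B (P - Q) ≥ ρ` (`IsRainsBounded`). This quantity is followed
through a protocol. PPT-preserving channels do not increase it (`IsRainsBounded.map`). One use of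
the channel multiplies it by at most `w`, provided that the Choi matrix of `N` lies below some `T_B
(Y - Z)` with `Y, Z ≥ 0` and `Tr_B (Y + Z) ≤ w • 1` (`IsRainsBounded.useChannel`). It starts at 1,
and a state with bound `c` has fidelity at most `c / M` with `Φ` (`IsRainsBounded.fidelity_le`).
Hence `1 - ε ≤ w ^ n / M`, and the fidelity decays exponentially once the rate exceeds `log₂ w`.

It remains to find such `Y, Z` for every `w > 2 ^ R_max(N)`. The definition of `R_max(N)` gives a
pair for each input state, with a bound only on the average of `Tr_B (Y + Z)` in that state. A
minimax argument by Hahn-Banach separation (`exists_le_smul_one_of_forall_trace_mul_le`) gives one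
pair that serves all states. Every `w` above the threshold is allowed, so no optimum has to be
attained.

The LOCC statements follow because LOCC channels are PPT-preserving and achievable rates never
exceed strong converse rates. -/

noncomputable section

/-! ### Positivity and the partial transpose -/

/-- Summing the blocks of a positive semidefinite block matrix gives a positive semidefinite
matrix. -/
theorem posSemidef_sum_blocks {A P : Type} [Fintype A] [Fintype P] {M : Op (A × P)}
    (hM : M.PosSemidef) :
    (Matrix.of fun p q => ∑ a, ∑ a', M (a, p) (a', q) : Op P).PosSemidef := by
  classical
  let W : Matrix (A × P) P ℂ := Matrix.of fun x q => if x.2 = q then 1 else 0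
  convert hM.conjTranspose_mul_mul_same W using 1
  ext p q
  simp [W, Matrix.mul_apply, Fintype.sum_prod_type, apply_ite]
  rw [Finset.sum_comm]

theorem partialTranspose_apply {A B : Type} (X : Op (A × B)) (p q : A × B) :
    partialTranspose A B X p q = X (p.1, q.2) (q.1, p.2) := rfl

@[simp]
theorem partialTranspose_partialTranspose {A B : Type} (X : Op (A × B)) :
    partialTranspose A B (partialTranspose A B X) = X := rfl

theorem idTensor_apply {R A B : Type} (Φ : Superop A B) (X : Op (R × A)) (p q : R × B) :
    idTensor R Φ X p q = Φ (Matrix.of fun a a' => X (p.1, a) (q.1, a')) p.2 q.2 := rfl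

theorem tensorId_apply {R A B : Type} (Φ : Superop A B) (X : Op (A × R)) (p q : B × R) :
    tensorId R Φ X p q = Φ (Matrix.of fun a a' => X (a, p.2) (a', q.2)) p.1 q.1 := rfl

theorem IsCompletelyPositive.idTensor_posSemidef {A B R : Type} [Fintype R] {Φ : Superop A B}
    (hΦ : IsCompletelyPositive Φ) {X : Op (R × A)} (hX : X.PosSemidef) :
    (idTensor R Φ X).PosSemidef := by
  let e := Fintype.equivFin R
  have h := hΦ _ _ (hX.submatrix (fun p : Fin (Fintype.card R) × A => (e.symm p.1, p.2)))
  convert h.submatrix (fun p : R × B => (e p.1, p.2)) using 1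
  ext p q
  simp [idTensor_apply]

theorem IsCompletelyPositive.map_posSemidef {A B : Type} {Φ : Superop A B}
    (hΦ : IsCompletelyPositive Φ) {X : Op A} (hX : X.PosSemidef) : (Φ X).PosSemidef :=
  (hΦ.idTensor_posSemidef (R := Unit) (hX.submatrix Prod.snd)).submatrix (fun b => ((), b))

/-! ### Maps given by Choi matrices -/

/-- The Choi matrix of `N`. -/
def choi {A B : Type} [DecidableEq A] (N : Superop A B) : Op (A × B) :=
  Matrix.of fun p q => N (Matrix.single p.1 q.1 1) p.2 q.2

/-- The partial trace over the second system. -/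
def partialTraceRight {A B : Type} [Fintype B] (X : Op (A × B)) : Op A :=
  Matrix.of fun a a' => ∑ b, X (a, b) (a', b)

/-- The action on the system `A` of `RA : C` of the map from `A` to `B` with Choi matrix `V`. -/
def applyChoi {R A B C : Type} [Fintype A] (V : Op (A × B)) (X : Op ((R × A) × C)) :
    Op (R × (B × C)) :=
  Matrix.of fun p q => ∑ a, ∑ a', X ((p.1, a), p.2.2) ((q.1, a'), q.2.2) *
    V (a, p.2.1) (a', q.2.1)

section applyChoi
variable {R A B C : Type} [Fintype A]

theorem applyChoi_add (V : Op (A × B)) (X Y : Op ((R × A) × C)) :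
    applyChoi V (X + Y) = applyChoi V X + applyChoi V Y := by
  ext p q; simp [applyChoi, add_mul, Finset.sum_add_distrib]

theorem applyChoi_sub (V : Op (A × B)) (X Y : Op ((R × A) × C)) :
    applyChoi V (X - Y) = applyChoi V X - applyChoi V Y := by
  ext p q; simp [applyChoi, sub_mul, Finset.sum_sub_distrib]

theorem add_applyChoi (V W : Op (A × B)) (X : Op ((R × A) × C)) :
    applyChoi (V + W) X = applyChoi V X + applyChoi W X := by
  ext p q; simp [applyChoi, mul_add, Finset.sum_add_distrib]

theorem sub_applyChoi (V W : Op (A × B)) (X : Op ((R × A) × C)) :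
    applyChoi (V - W) X = applyChoi V X - applyChoi W X := by
  ext p q; simp [applyChoi, mul_sub, Finset.sum_sub_distrib]

theorem partialTranspose_applyChoi (V : Op (A × B)) (X : Op ((R × A) × C)) :
    partialTranspose R (B × C) (applyChoi V X) =
      applyChoi (partialTranspose A B V) (partialTranspose (R × A) C X) := rfl

-- The output is a compression of `X ⊗ V`: both copies of `A` are contracted with the unnormalised
-- vector `∑ a, |a a⟩`.
open scoped Kronecker in
theorem applyChoi_posSemidef [Fintype R] [Fintype B] [Fintype C] {V : Op (A × B)}
    (hV : V.PosSemidef) {X : Op ((R × A) × C)} (hX : X.PosSemidef) :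
    (applyChoi V X).PosSemidef := by
  convert posSemidef_sum_blocks ((hX.kronecker hV).submatrix
    fun x : A × (R × (B × C)) => (((x.2.1, x.1), x.2.2.2), (x.1, x.2.2.1))) using 1
  ext p q
  simp [applyChoi]

theorem trace_applyChoi [Fintype R] [Fintype B] [Fintype C] (V : Op (A × B))
    (X : Op ((R × A) × C)) :
    (applyChoi V X).trace = ∑ a, ∑ a', (∑ r, ∑ c, X ((r, a), c) ((r, a'), c)) *
      partialTraceRight V a a' := by
  simp only [Matrix.trace, Matrix.diag, applyChoi, Matrix.of_apply, Fintype.sum_prod_type,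
    partialTraceRight, Finset.sum_mul, Finset.mul_sum]
  calc _ = ∑ r, ∑ b, ∑ a, ∑ c, ∑ a', X ((r, a), c) ((r, a'), c) * V (a, b) (a', b) :=
        Finset.sum_congr rfl fun r _ => Finset.sum_congr rfl fun b _ => Finset.sum_comm
    _ = ∑ r, ∑ a, ∑ b, ∑ a', ∑ c, X ((r, a), c) ((r, a'), c) * V (a, b) (a', b) :=
        Finset.sum_congr rfl fun r _ => by
          rw [Finset.sum_comm]
          exact Finset.sum_congr rfl fun b _ => Finset.sum_congr rfl fun a _ => Finset.sum_comm
    _ = ∑ a, ∑ r, ∑ a', ∑ c, ∑ b, X ((r, a), c) ((r, a'), c) * V (a, b) (a', b) := by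
          rw [Finset.sum_comm]
          refine Finset.sum_congr rfl fun a _ => Finset.sum_congr rfl fun r _ => ?_
          rw [Finset.sum_comm]
          exact Finset.sum_congr rfl fun a' _ => Finset.sum_comm
    _ = ∑ a, ∑ a', ∑ r, ∑ c, ∑ b, X ((r, a), c) ((r, a'), c) * V (a, b) (a', b) :=
          Finset.sum_congr rfl fun a _ => Finset.sum_comm
    _ = _ := by
          refine Finset.sum_congr rfl fun a _ => Finset.sum_congr rfl fun a' _ => ?_
          conv_rhs => rw [Finset.sum_comm]
          exact Finset.sum_congr rfl fun r _ => Finset.sum_comm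

/-- The trace of the output sees `V` only through `Tr_B V`. So the gap between the two sides is the
trace of the output of the map to a trivial system with Choi matrix `w • 1 - Tr_B V ≥ 0`. -/
theorem trace_applyChoi_le [DecidableEq A] [Fintype R] [Fintype B] [Fintype C] {V : Op (A × B)}
    {w : ℝ} (hV : ((w : ℂ) • (1 : Op A) - partialTraceRight V).PosSemidef)
    {X : Op ((R × A) × C)} (hX : X.PosSemidef) :
    (applyChoi V X).trace.re ≤ w * X.trace.re := by
  have h := (applyChoi_posSemidef (hV.submatrix (Prod.fst : A × Unit → A)) hX).trace_nonneg
  rw [trace_applyChoi] at h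
  have h1 : (partialTraceRight (((w : ℂ) • (1 : Op A) - partialTraceRight V).submatrix
      (Prod.fst : A × Unit → A) Prod.fst)) = (w : ℂ) • (1 : Op A) - partialTraceRight V := by
    ext a a'; simp [partialTraceRight]
  rw [h1] at h
  simp only [Matrix.sub_apply, mul_sub, Finset.sum_sub_distrib, ← trace_applyChoi] at h
  have h2 : ∑ a, ∑ a', (∑ r, ∑ c, X ((r, a), c) ((r, a'), c)) * ((w : ℂ) • (1 : Op A)) a a' =
      w * X.trace := by
    simp only [Matrix.smul_apply, Matrix.one_apply, smul_eq_mul, mul_ite, mul_one, mul_zero,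
      Finset.sum_ite_eq, Finset.mem_univ, if_true, Matrix.trace, Matrix.diag,
      Fintype.sum_prod_type, ← Finset.sum_mul]
    rw [Finset.sum_comm, mul_comm]
  rw [h2] at h
  have := (Complex.le_def.1 h).1
  simpa using this

end applyChoi

theorem map_eq_sum_choi {A B : Type} [Fintype A] [DecidableEq A] (N : Superop A B) (X : Op A)
    (b b' : B) : N X b b' = ∑ a, ∑ a', X a a' * choi N (a, b) (a', b') := by
  conv_lhs => rw [Matrix.matrix_eq_sum_single X]
  have h (a a' : A) : Matrix.single a a' (X a a') = X a a' • Matrix.single a a' (1 : ℂ) := by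
    simp
  simp only [h, map_sum, map_smul, Matrix.sum_apply, Matrix.smul_apply, smul_eq_mul]
  rfl

theorem useChannel_eq_applyChoi {A B A' B' : Type} [Fintype A] [DecidableEq A] (N : Superop A B)
    (ρ : Op ((A' × A) × B')) : useChannel N A' B' ρ = applyChoi (choi N) ρ := by
  ext p q
  simp [useChannel, idTensor_apply, tensorId_apply, map_eq_sum_choi N, applyChoi]

theorem IsCompletelyPositive.choi_posSemidef {A B : Type} [Fintype A] [DecidableEq A]
    {N : Superop A B} (hN : IsCompletelyPositive N) : (choi N).PosSemidef := by
  let Γ : A × A → ℂ := fun p => if p.1 = p.2 then 1 else 0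
  convert hN.idTensor_posSemidef (Matrix.posSemidef_vecMulVec_self_star Γ) using 1
  ext p q
  have h : Matrix.single p.1 q.1 (1 : ℂ) =
      Matrix.of fun a a' => Matrix.vecMulVec Γ (star Γ) (p.1, a) (q.1, a') := by
    ext a a'
    by_cases h1 : p.1 = a <;> by_cases h2 : q.1 = a' <;>
      simp [Γ, Matrix.vecMulVec_apply, h1, h2]
  rw [idTensor_apply, ← h]
  rfl

/-! ### The max-Rains bound along a protocol -/

/-- Some `σ ≥ ρ` has a partial transpose of the form `P - Q` with `P, Q ≥ 0` and
`Tr (P + Q) ≤ c`. -/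
def IsRainsBounded {A B : Type} [Fintype A] [Fintype B] (c : ℝ) (ρ : Op (A × B)) : Prop :=
  ∃ P Q : Op (A × B), P.PosSemidef ∧ Q.PosSemidef ∧
    (partialTranspose A B (P - Q) - ρ).PosSemidef ∧ (P + Q).trace.re ≤ c

/-- The Choi matrix of `N` is dominated by the partial transpose of some `Y - Z` with `Y, Z ≥ 0`
and `Tr_B (Y + Z) ≤ w`. -/
def IsChoiRainsBounded {A B : Type} [Fintype B] [DecidableEq A] (w : ℝ)
    (N : Superop A B) : Prop :=
  ∃ Y Z : Op (A × B), Y.PosSemidef ∧ Z.PosSemidef ∧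
    (partialTranspose A B (Y - Z) - choi N).PosSemidef ∧
    ((w : ℂ) • (1 : Op A) - partialTraceRight (Y + Z)).PosSemidef

/-- The new witnesses are the images of the old ones under the channel `T ∘ P ∘ T`, which preserves
positivity and trace; positivity of `P` itself preserves the domination. -/
theorem IsRainsBounded.map {A B A' B' : Type} [Fintype A] [Fintype B] [Fintype A'] [Fintype B']
    {P : Superop (A × B) (A' × B')} (hP : IsPPTPreserving A B A' B' P) {c : ℝ} {ρ : Op (A × B)}
    (hρ : IsRainsBounded c ρ) : IsRainsBounded c (P ρ) := by
  obtain ⟨Y, Z, hY, hZ, h, hc⟩ := hρ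
  refine ⟨_, _, hP.2.1.map_posSemidef hY, hP.2.1.map_posSemidef hZ, ?_, ?_⟩
  · rw [← map_sub]
    have := hP.1.1.map_posSemidef h
    rwa [map_sub] at this
  · rw [← map_add, hP.2.2]
    exact hc

theorem isRainsBounded_one : IsRainsBounded 1 (1 : Op (Unit × Unit)) := by
  refine ⟨1, 0, .one, .zero, ?_, by simp⟩
  have : partialTranspose Unit Unit (1 - 0) - 1 = 0 := by
    ext p q
    simp [partialTranspose_apply, Subsingleton.elim p q]
  rw [this]
  exact .zero

/-- The bound is submultiplicative: with `·` for `applyChoi`, `(Y - Z) · (P - Q)` splits into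
positive parts `Y · P + Z · Q` and `Z · P + Y · Q`, whose sum is `(Y + Z) · (P + Q)`. -/
theorem IsRainsBounded.useChannel {A B A' B' : Type} [Fintype A] [Fintype B] [Fintype A']
    [Fintype B'] [DecidableEq A] {N : Superop A B} (hN : IsCompletelyPositive N) {w c : ℝ}
    (hw : 0 ≤ w) (hNw : IsChoiRainsBounded w N) {ρ : Op ((A' × A) × B')} (hρ : ρ.PosSemidef)
    (h : IsRainsBounded c ρ) : IsRainsBounded (w * c) (useChannel N A' B' ρ) := by
  obtain ⟨Y, Z, hY, hZ, hYZ, hw'⟩ := hNw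
  obtain ⟨P, Q, hP, hQ, hPQ, hc⟩ := h
  rw [useChannel_eq_applyChoi]
  refine ⟨applyChoi Y P + applyChoi Z Q, applyChoi Z P + applyChoi Y Q,
    (applyChoi_posSemidef hY hP).add (applyChoi_posSemidef hZ hQ),
    (applyChoi_posSemidef hZ hP).add (applyChoi_posSemidef hY hQ), ?_, ?_⟩
  · have hV : (partialTranspose A B (Y - Z)).PosSemidef := by
      simpa using hYZ.add hN.choi_posSemidef
    have h1 : applyChoi Y P + applyChoi Z Q - (applyChoi Z P + applyChoi Y Q) =
        applyChoi (Y - Z) (P - Q) := by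
      simp only [sub_applyChoi, applyChoi_sub]
      abel
    rw [h1, partialTranspose_applyChoi]
    -- Telescoping: replace `ρ` by `T (P - Q)` under the dominating map, and the Choi matrix of `N`
    -- by `T (Y - Z)` on `ρ`. The second replacement needs `ρ ≥ 0`.
    have := (applyChoi_posSemidef hV hPQ).add (applyChoi_posSemidef hYZ hρ)
    rwa [applyChoi_sub, sub_applyChoi, sub_add_sub_cancel] at this
  · have h1 : applyChoi Y P + applyChoi Z Q + (applyChoi Z P + applyChoi Y Q) =
        applyChoi (Y + Z) (P + Q) := by
      simp only [add_applyChoi, applyChoi_add]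
      abel
    rw [h1]
    exact (trace_applyChoi_le hw' (hP.add hQ)).trans (mul_le_mul_of_nonneg_left hc hw)

theorem IsProtocolState.posSemidef_and_isRainsBounded {A B : Type} [Fintype A] [Fintype B]
    [DecidableEq A] {N : Superop A B} (hN : IsCompletelyPositive N) {w : ℝ} (hw : 0 ≤ w)
    (hNw : IsChoiRainsBounded w N) {n a b : ℕ} {σ : Op (Fin a × (B × Fin b))}
    (hσ : IsProtocolState IsPPTPreserving N n a b σ) :
    σ.PosSemidef ∧ IsRainsBounded (w ^ n) σ := by
  induction hσ with
  | first a b P hP =>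
    have h := hP.1.1.map_posSemidef (Matrix.PosSemidef.one (n := Unit × Unit) (R := ℂ))
    refine ⟨?_, ?_⟩
    · rw [useChannel_eq_applyChoi]
      exact applyChoi_posSemidef hN.choi_posSemidef h
    · simpa using (isRainsBounded_one.map hP).useChannel hN hw hNw h
  | next n a b a' b' σ _ P hP ih =>
    have h := hP.1.1.map_posSemidef ih.1
    refine ⟨?_, ?_⟩
    · rw [useChannel_eq_applyChoi]
      exact applyChoi_posSemidef hN.choi_posSemidef h
    · rw [pow_succ']
      exact (ih.2.map hP).useChannel hN hw hNw h

/-- The partial transpose of `|Φ⟩⟨Φ|` is the swap operator divided by `M`. -/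
theorem fidelity_partialTranspose (M : ℕ) (X : Op (Fin M × Fin M)) :
    star (maxEntangled M) ⬝ᵥ ((partialTranspose _ _ X).mulVec (maxEntangled M)) =
      (∑ i, ∑ j, X (i, j) (j, i)) / M := by
  have h : ((1 / Real.sqrt M : ℝ) : ℂ) * ((1 / Real.sqrt M : ℝ) : ℂ) = 1 / M := by
    rw [← Complex.ofReal_mul, div_mul_div_comm, Real.mul_self_sqrt (Nat.cast_nonneg M)]
    simp
  simp only [dotProduct, Matrix.mulVec, Fintype.sum_prod_type, Pi.star_apply, maxEntangled,
    partialTranspose_apply, Finset.sum_div]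
  refine Finset.sum_congr rfl fun i _ => ?_
  simp only [apply_ite, star_zero, ite_mul, zero_mul, mul_zero, Finset.sum_ite_irrel, Finset.sum_const_zero, Finset.sum_ite_eq,
    Finset.mem_univ, if_true, Finset.mul_sum, RCLike.star_def, Complex.conj_ofReal]
  refine Finset.sum_congr rfl fun j _ => ?_
  linear_combination X (i, j) (j, i) * h

/-- The sum is the trace of `X` against the swap, whose eigenvalues are `±1`. -/
theorem abs_sum_swap_le {n : Type} [Fintype n] {X : Op (n × n)} (hX : X.PosSemidef) :
    |(∑ i, ∑ j, X (i, j) (j, i)).re| ≤ X.trace.re := by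
  have key (s : ℝ) (hs : s * s = 1) (i j : n) :
      0 ≤ (X (i, j) (i, j)).re + (X (j, i) (j, i)).re +
        s * ((X (i, j) (j, i)).re + (X (j, i) (i, j)).re) := by
    classical
    -- For `s = ±1` the test vectors `|ij⟩ + s |ji⟩` are swap eigenvectors; summing over `i, j`
    -- gives twice the desired inequality.
    have h := hX.dotProduct_mulVec_nonneg (Pi.single (i, j) 1 + Pi.single (j, i) (s : ℂ))
    have h2 := (Complex.le_def.1 h).1
    simp [Matrix.mulVec_add, add_dotProduct, dotProduct_add, Matrix.mulVec_single,
      Pi.star_single, star_add] at h2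
    have : s * (s * (X (j, i) (j, i)).re) = (X (j, i) (j, i)).re := by
      rw [← mul_assoc, hs, one_mul]
    linarith
  have htr : X.trace.re = ∑ i, ∑ j, (X (i, j) (i, j)).re := by
    simp [Matrix.trace, Fintype.sum_prod_type]
  have htr' : X.trace.re = ∑ i, ∑ j, (X (j, i) (j, i)).re := by
    rw [htr, Finset.sum_comm]
  have hsw : (∑ i, ∑ j, X (i, j) (j, i)).re = ∑ i, ∑ j, (X (i, j) (j, i)).re := by simp
  have hsw' : (∑ i, ∑ j, X (i, j) (j, i)).re = ∑ i, ∑ j, (X (j, i) (i, j)).re := by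
    rw [hsw, Finset.sum_comm]
  have tot (s : ℝ) (hs : s * s = 1) :
      0 ≤ X.trace.re + s * (∑ i, ∑ j, X (i, j) (j, i)).re := by
    have h := Finset.sum_nonneg fun i (_ : i ∈ Finset.univ) =>
      Finset.sum_nonneg fun j (_ : j ∈ Finset.univ) => key s hs i j
    simp only [Finset.sum_add_distrib, ← Finset.mul_sum, ← htr, ← htr', ← hsw, ← hsw'] at h
    linarith
  have h1 := tot 1 (by norm_num)
  have h2 := tot (-1) (by norm_num)
  rw [abs_le]
  constructor <;> linarith

theorem IsRainsBounded.fidelity_le {M : ℕ} {c : ℝ} {ω : Op (Fin M × Fin M)}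
    (h : IsRainsBounded c ω) :
    (star (maxEntangled M) ⬝ᵥ (ω.mulVec (maxEntangled M))).re ≤ c / M := by
  obtain ⟨P, Q, hP, hQ, hPQ, hc⟩ := h
  have h1 := (Complex.le_def.1 (hPQ.dotProduct_mulVec_nonneg (maxEntangled M))).1
  rw [Matrix.sub_mulVec, dotProduct_sub, fidelity_partialTranspose] at h1
  have h2 : ((∑ i, ∑ j, (P - Q) (i, j) (j, i)) / (M : ℂ)).re =
      ((∑ i, ∑ j, P (i, j) (j, i)).re - (∑ i, ∑ j, Q (i, j) (j, i)).re) / M := by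
    rw [Complex.div_natCast_re]
    simp [Finset.sum_sub_distrib]
  rw [Complex.sub_re, h2] at h1
  have h3 := abs_le.1 (abs_sum_swap_le hP)
  have h4 := abs_le.1 (abs_sum_swap_le hQ)
  rw [Matrix.trace_add, Complex.add_re] at hc
  have h5 : ((∑ i, ∑ j, P (i, j) (j, i)).re - (∑ i, ∑ j, Q (i, j) (j, i)).re) / (M : ℝ) ≤ c / M :=
    div_le_div_of_nonneg_right (by linarith) (Nat.cast_nonneg M)
  rw [Complex.zero_re] at h1
  linarith

theorem HasProtocol.one_sub_le {A B : Type} [Fintype A] [Fintype B] [DecidableEq A]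
    {N : Superop A B} (hN : IsCompletelyPositive N) {w : ℝ} (hw : 0 ≤ w)
    (hNw : IsChoiRainsBounded w N) {n M : ℕ} {ε : ℝ}
    (h : HasProtocol IsPPTPreserving N n M ε) : 1 - ε ≤ w ^ n / M := by
  obtain ⟨a, b, σ, P, hσ, hP, hε⟩ := h
  exact hε.trans (((hσ.posSemidef_and_isRainsBounded hN hw hNw).2.map hP).fidelity_le)

/-! ### A minimax theorem for density operators -/

theorem posSemidef_of_trace_mul_nonneg {A : Type} [Fintype A] {H : Op A} (hH : H.IsHermitian)
    (h : ∀ X : Op A, X.PosSemidef → 0 ≤ (H * X).trace.re) : H.PosSemidef := by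
  refine .of_dotProduct_mulVec_nonneg hH fun x => ?_
  have h1 := h _ (Matrix.posSemidef_vecMulVec_self_star x)
  rw [Matrix.mul_vecMulVec, Matrix.trace_vecMulVec, dotProduct_comm] at h1
  rw [Complex.le_def]
  exact ⟨h1, (hH.im_star_dotProduct_mulVec_self x).symm⟩

section minimax
variable {A : Type} [Fintype A] [DecidableEq A]

open scoped MatrixOrder Matrix.Norms.L2Operator in
theorem Matrix.IsHermitian.exists_smul_one_sub_posSemidef {X : Op A} (hX : X.IsHermitian) :
    ∃ c : ℝ, (c • (1 : Op A) - X).PosSemidef := by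
  refine ⟨‖X‖, ?_⟩
  have h := IsSelfAdjoint.le_algebraMap_norm_self (a := X) hX
  rwa [Matrix.le_iff, Algebra.algebraMap_eq_smul_one] at h

-- The set consists of the `X` whose Hermitian part lies strictly above an element of `F`. Using the
-- Hermitian part makes it open among all matrices, and the slack `η` removes any need for `F` to be
-- closed.
open scoped MatrixOrder Matrix.Norms.L2Operator in
theorem isOpen_strict_upper_set (F : Set (Op A)) :
    IsOpen {X : Op A | ∃ G ∈ F, ∃ η > (0 : ℝ),
      (X + X.conjTranspose - (2 : ℝ) • G - η • (1 : Op A)).PosSemidef} := by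
  rw [Metric.isOpen_iff]
  rintro X ⟨G, hG, η, hη, h⟩
  refine ⟨η / 4, by positivity, fun X' hX' => ⟨G, hG, η / 2, by positivity, ?_⟩⟩
  rw [Metric.mem_ball, dist_eq_norm] at hX'
  set D := X' - X with hD
  have hDs : IsSelfAdjoint (D + star D) := .add_star_self D
  have hn : ‖D + star D‖ ≤ η / 2 := by
    have := norm_add_le D (star D)
    rw [norm_star] at this
    linarith
  have h1 := hDs.neg_algebraMap_norm_le_self
  rw [Matrix.le_iff, Algebra.algebraMap_eq_smul_one] at h1
  have h2 : ((η / 2 - ‖D + star D‖) • (1 : Op A)).PosSemidef :=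
    Matrix.PosSemidef.one.smul (by linarith)
  convert (h.add h1).add h2 using 1
  rw [hD, star_sub, Matrix.star_eq_conjTranspose, Matrix.star_eq_conjTranspose]
  module

theorem linearMap_eq_trace_mul (f : Op A →ₗ[ℂ] ℂ) : ∃ H : Op A, ∀ X, f X = (H * X).trace := by
  refine ⟨Matrix.of fun i j => f (Matrix.single j i 1), fun X => ?_⟩
  conv_lhs => rw [Matrix.matrix_eq_sum_single X]
  have h (a a' : A) : Matrix.single a a' (X a a') = X a a' • Matrix.single a a' (1 : ℂ) := by
    simp
  simp only [h, map_sum, map_smul, smul_eq_mul, Matrix.trace, Matrix.diag, Matrix.mul_apply,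
    Matrix.of_apply]
  rw [Finset.sum_comm]
  simp only [mul_comm]

/-- If every density operator `H > 0` has expectation at most `w` on some element of a convex set
`F` of positive semidefinite operators, then `F` has an element below any multiple `w' > w` of the
identity. -/
theorem exists_le_smul_one_of_forall_trace_mul_le [Nonempty A] {F : Set (Op A)}
    (hF : Convex ℝ F) (hF0 : ∀ X ∈ F, X.PosSemidef) {w w' : ℝ} (hw : 0 ≤ w) (hw' : w < w')
    (h : ∀ H : Op A, H.PosDef → H.trace = 1 → ∃ X ∈ F, (H * X).trace.re ≤ w) :
    ∃ X ∈ F, (w' • (1 : Op A) - X).PosSemidef := by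
  set S := {X : Op A | ∃ G ∈ F, ∃ η > (0 : ℝ),
      (X + X.conjTranspose - (2 : ℝ) • G - η • (1 : Op A)).PosSemidef} with hS
  have hSF {X G : Op A} (hG : G ∈ F) (hX : X.IsHermitian) {η : ℝ} (hη : 0 < η)
      (hXG : (X - G - η • (1 : Op A)).PosSemidef) : X ∈ S := by
    refine ⟨G, hG, 2 * η, by positivity, ?_⟩
    convert hXG.add hXG using 1
    rw [hX.eq]
    module
  have hone (c : ℝ) : (c • (1 : Op A)).IsHermitian := by
    simp [Matrix.IsHermitian, Matrix.conjTranspose_smul]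
  -- If `w' • 1` lies in the open upper set `S`, the proof is done; otherwise it can be separated
  -- from `S`, and the separating functional yields a state violating `h`.
  by_cases hmem : w' • (1 : Op A) ∈ S
  · obtain ⟨G, hG, η, hη, hGη⟩ := hmem
    refine ⟨G, hG, ?_⟩
    have h1 : (η • (1 : Op A)).PosSemidef := Matrix.PosSemidef.one.smul hη.le
    convert (hGη.add h1).smul (show (0 : ℝ) ≤ 1 / 2 by norm_num) using 1
    rw [(hone w').eq]
    module
  exfalso
  have hconv : Convex ℝ S := by
    rintro X ⟨G, hG, η, hη, hX⟩ Y ⟨G', hG', η', hη', hY⟩ a b ha hb hab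
    refine ⟨a • G + b • G', hF hG hG' ha hb hab, a * η + b * η', ?_, ?_⟩
    · rcases ha.eq_or_lt with rfl | ha
      · have : b = 1 := by linarith
        subst this; linarith
      · have := mul_pos ha hη
        have := mul_nonneg hb hη'.le
        linarith
    · convert (hX.smul ha).add (hY.smul hb) using 1
      rw [Matrix.conjTranspose_add, Matrix.conjTranspose_smul, Matrix.conjTranspose_smul,
        star_trivial, star_trivial]
      module
  obtain ⟨f, hf⟩ : ∃ f : Op A →ₗ[ℂ] ℂ, ∀ X ∈ S, (f X).re < (f (w' • (1 : Op A))).re := by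
    open scoped Matrix.Norms.L2Operator in
    obtain ⟨f, hf⟩ := RCLike.geometric_hahn_banach_open_point (𝕜 := ℂ) hconv
      (isOpen_strict_upper_set F) hmem
    exact ⟨f, hf⟩
  obtain ⟨H₀, hH₀⟩ := linearMap_eq_trace_mul f
  -- the Hermitian operator representing the functional on Hermitian operators
  set H₁ : Op A := -(H₀ + H₀.conjTranspose) with hH₁
  have hH₁h : H₁.IsHermitian := by
    simp [hH₁, Matrix.IsHermitian, add_comm]
  have hH₁f {X : Op A} (hX : X.IsHermitian) : (H₁ * X).trace.re = -2 * (f X).re := by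
    have h1 : (H₀.conjTranspose * X).trace = star (H₀ * X).trace := by
      rw [← Matrix.trace_conjTranspose, Matrix.conjTranspose_mul, hX.eq, Matrix.trace_mul_comm]
    rw [hH₁, Matrix.neg_mul, Matrix.add_mul, Matrix.trace_neg, Matrix.trace_add, h1, ← hH₀]
    simp
    ring
  have hsep {X G : Op A} (hG : G ∈ F) (hX : X.IsHermitian) {η : ℝ} (hη : 0 < η)
      (hXG : (X - G - η • (1 : Op A)).PosSemidef) :
      w' * H₁.trace.re < (H₁ * X).trace.re := by
    have h1 := hf X (hSF hG hX hη hXG)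
    have h2 := hH₁f (hone w')
    rw [Matrix.mul_smul, Matrix.mul_one, Matrix.trace_smul, Complex.smul_re, smul_eq_mul] at h2
    rw [h2, hH₁f hX]
    linarith
  obtain ⟨G₀, hG₀, c, hc⟩ : ∃ G ∈ F, ∃ c : ℝ, (c • (1 : Op A) - G).PosSemidef := by
    obtain ⟨G, hG, -⟩ := h ((1 / (Fintype.card A : ℝ)) • (1 : Op A))
      (Matrix.PosDef.one.smul (by positivity)) (by simp)
    exact ⟨G, hG, (hF0 G hG).1.exists_smul_one_sub_posSemidef⟩
  have hc1 : ((c + 1) • (1 : Op A) - G₀ - (1 : ℝ) • (1 : Op A)).PosSemidef := by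
    convert hc using 1
    module
  -- `S` is closed under adding positive operators, so a positive `X` with `Tr (H₁ X) < 0` could be
  -- added with a large coefficient, breaking the separation.
  have hH₁p : H₁.PosSemidef := by
    refine posSemidef_of_trace_mul_nonneg hH₁h fun X hX => ?_
    by_contra! hneg
    have key (t : ℝ) (ht : 0 ≤ t) :
        w' * H₁.trace.re < (c + 1) * H₁.trace.re + t * (H₁ * X).trace.re := by
      have := hsep (X := (c + 1) • (1 : Op A) + t • X) hG₀
        ((hone _).add (hX.smul ht).1) one_pos (by
          convert hc1.add (hX.smul ht) using 1
          module)
      simpa [Matrix.mul_add, Matrix.trace_smul] using this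
    have := key (|w' * H₁.trace.re - (c + 1) * H₁.trace.re| / -(H₁ * X).trace.re)
      (div_nonneg (abs_nonneg _) (by linarith))
    have h3 : |w' * H₁.trace.re - (c + 1) * H₁.trace.re| / -(H₁ * X).trace.re *
        (H₁ * X).trace.re = -|w' * H₁.trace.re - (c + 1) * H₁.trace.re| := by
      rw [div_neg, neg_mul, div_mul_cancel₀ _ hneg.ne]
    rw [h3] at this
    have := neg_abs_le (w' * H₁.trace.re - (c + 1) * H₁.trace.re)
    linarith
  have hT : 0 < H₁.trace.re := by
    refine lt_of_le_of_ne (Complex.le_def.1 hH₁p.trace_nonneg).1 fun h0 => ?_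
    have := hsep hG₀ (hone _) one_pos hc1
    rw [Matrix.mul_smul, Matrix.mul_one, Matrix.trace_smul, Complex.smul_re, smul_eq_mul, ← h0] at this
    simp at this
  have hTim : H₁.trace.im = 0 := (Complex.le_def.1 hH₁p.trace_nonneg).2.symm
  -- Elements of `F` are only limits of points of `S`, so the strict inequality becomes weak.
  have hsepF {G : Op A} (hG : G ∈ F) : w' * H₁.trace.re ≤ (H₁ * G).trace.re := by
    refine le_of_forall_pos_lt_add fun η hη => ?_
    have := hsep (X := G + (η / H₁.trace.re) • (1 : Op A)) hG ((hF0 G hG).1.add (hone _))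
      (div_pos hη hT) (by
        convert Matrix.PosSemidef.zero using 1
        module)
    simpa [Matrix.mul_add, Matrix.trace_smul, hT.ne'] using this
  -- `H₁` may be singular, so its normalisation is mixed with a weight `θ` of the maximally mixed
  -- state. This `θ` gives `(1 - θ) w' = (w + w') / 2`, still above `w`.
  obtain ⟨θ, hθ0, hθ1, hθ⟩ : ∃ θ : ℝ, 0 < θ ∧ θ < 1 ∧ w < (1 - θ) * w' := by
    have hw'0 : 0 < w' := by linarith
    refine ⟨(w' - w) / (2 * w'), by apply div_pos <;> linarith, ?_, ?_⟩
    · rw [div_lt_one (by linarith)]; linarith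
    · field_simp; linarith
  have hd : (0 : ℝ) < Fintype.card A := by positivity
  obtain ⟨G, hG, hGw⟩ := h (((1 - θ) / H₁.trace.re) • H₁ + (θ / Fintype.card A) • (1 : Op A))
    (Matrix.PosDef.posSemidef_add (hH₁p.smul (div_nonneg (by linarith) hT.le))
      (Matrix.PosDef.one.smul (div_pos hθ0 hd)))
    (by
      rw [Matrix.trace_add, Matrix.trace_smul, Matrix.trace_smul, Matrix.trace_one]
      apply Complex.ext
      · simp only [Complex.add_re, Complex.smul_re, smul_eq_mul, Complex.natCast_re, Complex.one_re]
        field_simp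
        ring
      · simp [hTim])
  rw [Matrix.add_mul, Matrix.trace_add, Matrix.smul_mul, Matrix.smul_mul, Matrix.one_mul,
    Matrix.trace_smul, Matrix.trace_smul, Complex.add_re, Complex.smul_re, Complex.smul_re,
    smul_eq_mul, smul_eq_mul] at hGw
  have h1 : 0 ≤ θ / Fintype.card A * G.trace.re :=
    mul_nonneg (div_pos hθ0 hd).le (Complex.le_def.1 (hF0 G hG).trace_nonneg).1
  have h2 : (1 - θ) / H₁.trace.re * (w' * H₁.trace.re) ≤
      (1 - θ) / H₁.trace.re * (H₁ * G).trace.re :=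
    mul_le_mul_of_nonneg_left (hsepF hG) (div_nonneg (by linarith) hT.le)
  have h3 : (1 - θ) / H₁.trace.re * (w' * H₁.trace.re) = (1 - θ) * w' := by
    field_simp
  linarith

end minimax

/-! ### Dominating the Choi matrix -/

open scoped MatrixOrder in
theorem Matrix.IsHermitian.exists_eq_sub_trace_add_eq_traceNorm {A : Type} [Fintype A]
    [DecidableEq A] {X : Op A} (hX : X.IsHermitian) :
    ∃ P Q : Op A, P.PosSemidef ∧ Q.PosSemidef ∧ X = P - Q ∧ (P + Q).trace.re = traceNorm X := by
  refine ⟨X⁺, X⁻, Matrix.nonneg_iff_posSemidef.1 (CFC.posPart_nonneg X),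
    Matrix.nonneg_iff_posSemidef.1 (CFC.negPart_nonneg X),
    (CFC.posPart_sub_negPart X hX).symm, ?_⟩
  rw [CFC.posPart_add_negPart X hX, traceNorm]

theorem Matrix.IsHermitian.partialTranspose {A B : Type} {X : Op (A × B)} (hX : X.IsHermitian) :
    (partialTranspose A B X).IsHermitian := by
  ext p q
  exact hX.apply _ _

section localConj
open scoped Kronecker
variable {A B : Type} [Fintype A] [Fintype B] [DecidableEq B]

/-- Conjugation of an operator on `AB` by `K ⊗ 1`. -/
def localConj (K : Op A) (X : Op (A × B)) : Op (A × B) :=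
  (K ⊗ₖ (1 : Op B)) * X * (K ⊗ₖ (1 : Op B)).conjTranspose

theorem localConj_apply (K : Op A) (X : Op (A × B)) (p q : A × B) :
    localConj K X p q = ∑ a, ∑ a', K p.1 a * X (a, p.2) (a', q.2) * star (K q.1 a') := by
  simp only [localConj, Matrix.mul_apply, Fintype.sum_prod_type, Matrix.kroneckerMap_apply,
    Matrix.conjTranspose_apply, Matrix.one_apply, mul_ite, mul_one, mul_zero, ite_mul, zero_mul,
    Finset.sum_ite_eq, Finset.mem_univ, if_true, apply_ite star, star_zero, Finset.sum_mul]
  rw [Finset.sum_comm]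

theorem Matrix.PosSemidef.localConj {X : Op (A × B)} (hX : X.PosSemidef) (K : Op A) :
    (localConj K X).PosSemidef :=
  hX.mul_mul_conjTranspose_same _

theorem localConj_sub (K : Op A) (X Y : Op (A × B)) :
    localConj K (X - Y) = localConj K X - localConj K Y := by
  simp [localConj, mul_sub, sub_mul]

theorem localConj_add (K : Op A) (X Y : Op (A × B)) :
    localConj K (X + Y) = localConj K X + localConj K Y := by
  simp [localConj, mul_add, add_mul]

theorem localConj_inv_localConj [DecidableEq A] {K : Op A} (hK : IsUnit K) (X : Op (A × B)) :
    localConj K⁻¹ (localConj K X) = X := by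
  have h : (K⁻¹ ⊗ₖ (1 : Op B)) * (K ⊗ₖ (1 : Op B)) = 1 := by
    rw [← Matrix.mul_kronecker_mul, Matrix.nonsing_inv_mul _ ((Matrix.isUnit_iff_isUnit_det K).1 hK)]
    simp
  have h' := congrArg Matrix.conjTranspose h
  rw [Matrix.conjTranspose_mul, Matrix.conjTranspose_one] at h'
  calc localConj K⁻¹ (localConj K X) = ((K⁻¹ ⊗ₖ (1 : Op B)) * (K ⊗ₖ (1 : Op B))) * X *
        ((K ⊗ₖ (1 : Op B)).conjTranspose * (K⁻¹ ⊗ₖ (1 : Op B)).conjTranspose) := by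
        simp only [localConj, Matrix.mul_assoc]
    _ = X := by rw [h, h', Matrix.one_mul, Matrix.mul_one]

theorem partialTranspose_localConj (K : Op A) (X : Op (A × B)) :
    partialTranspose A B (localConj K X) = localConj K (partialTranspose A B X) := by
  ext p q
  simp only [partialTranspose_apply, localConj_apply]

theorem partialTraceRight_localConj (K : Op A) (X : Op (A × B)) :
    partialTraceRight (localConj K X) = K * partialTraceRight X * K.conjTranspose := by
  ext a a'
  simp only [partialTraceRight, localConj_apply, Matrix.of_apply, Matrix.mul_apply,
    Matrix.conjTranspose_apply, Finset.sum_mul, Finset.mul_sum]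
  rw [Finset.sum_comm]
  conv_rhs => rw [Finset.sum_comm]
  exact Finset.sum_congr rfl fun _ _ => Finset.sum_comm

/-- Every vector of `A ⊗ A` is `K ⊗ 1` applied to `∑ a, |a a⟩`, and `K` acts on the reference system
only, so it commutes with `N`. -/
theorem idTensor_vecMulVec_eq_localConj [DecidableEq A] (N : Superop A B) (K : Op A) :
    idTensor A N (Matrix.vecMulVec (fun p : A × A => K p.1 p.2)
      (star fun p : A × A => K p.1 p.2)) = localConj K (choi N) := by
  ext p q
  rw [idTensor_apply, map_eq_sum_choi, localConj_apply]
  simp only [Matrix.of_apply, Matrix.vecMulVec_apply, Pi.star_apply]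
  exact Finset.sum_congr rfl fun _ _ => Finset.sum_congr rfl fun _ _ => by ring

end localConj

theorem partialTraceRight_posSemidef {A B : Type} [Fintype A] [Fintype B] {X : Op (A × B)}
    (hX : X.PosSemidef) : (partialTraceRight X).PosSemidef := by
  convert Matrix.posSemidef_sum Finset.univ
    fun b _ => hX.submatrix fun a : A => (a, b) using 1
  ext a a'
  simp [partialTraceRight, Matrix.sum_apply]

theorem partialTraceRight_add {A B : Type} [Fintype B] (X Y : Op (A × B)) :
    partialTraceRight (X + Y) = partialTraceRight X + partialTraceRight Y := by
  ext a a'; simp [partialTraceRight, Finset.sum_add_distrib]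

theorem partialTraceRight_smul {A B : Type} [Fintype B] (c : ℝ) (X : Op (A × B)) :
    partialTraceRight (c • X) = c • partialTraceRight X := by
  ext a a'; simp [partialTraceRight, Finset.mul_sum]

theorem trace_partialTraceRight {A B : Type} [Fintype A] [Fintype B] (X : Op (A × B)) :
    (partialTraceRight X).trace = X.trace := by
  simp [partialTraceRight, Matrix.trace, Fintype.sum_prod_type]

section
variable {A B : Type} [Fintype A] [DecidableEq A] [Fintype B] [DecidableEq B]

/-- The witnesses are `2 ^ t` times the positive and negative parts of `T_B σ`, for a nearly optimal
`σ`. -/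
theorem exists_posSemidef_of_maxRainsRelEntropy_lt {ρ : Op (A × B)} {R : ℝ}
    (h : maxRainsRelEntropy ρ < R) :
    ∃ P Q : Op (A × B), P.PosSemidef ∧ Q.PosSemidef ∧
      (partialTranspose A B (P - Q) - ρ).PosSemidef ∧ (P + Q).trace.re ≤ 2 ^ R := by
  simp only [maxRainsRelEntropy, maxRelEntropy, iInf_lt_iff] at h
  obtain ⟨σ, ⟨hσ, hσ1⟩, t, ht, htR⟩ := h
  obtain ⟨P, Q, hP, hQ, hPQ, htr⟩ := hσ.1.partialTranspose.exists_eq_sub_trace_add_eq_traceNorm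
  have h2 : (0 : ℝ) < 2 ^ t := by positivity
  refine ⟨(2 : ℝ) ^ t • P, (2 : ℝ) ^ t • Q, hP.smul h2.le, hQ.smul h2.le, ?_, ?_⟩
  · rw [← smul_sub, ← hPQ]
    exact ht
  · rw [← smul_add, Matrix.trace_smul, Complex.smul_re, htr, smul_eq_mul]
    calc (2 : ℝ) ^ t * _ ≤ 2 ^ t * 1 := mul_le_mul_of_nonneg_left hσ1 h2.le
      _ ≤ 2 ^ R := by
        rw [mul_one]
        exact Real.rpow_le_rpow_of_exponent_le one_le_two (EReal.coe_lt_coe_iff.1 htR).le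

/-- For `H = K† K` the input vector with coefficient matrix `K` has output `K Γ K†`, where `Γ` is
the Choi matrix of `N`. Since `H` is positive definite, `K` is invertible, and conjugating the
witnesses for the output by `K⁻¹` gives witnesses for `Γ`; their weight against `H` is the original
trace. -/
theorem exists_trace_mul_le_of_maxRainsInformation_lt {N : Superop A B} {R : ℝ}
    (hR : maxRainsInformation N < R) {H : Op A} (hH : H.PosDef) (hH1 : H.trace = 1) :
    ∃ Y Z : Op (A × B), Y.PosSemidef ∧ Z.PosSemidef ∧
      (partialTranspose A B (Y - Z) - choi N).PosSemidef ∧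
      (H * partialTraceRight (Y + Z)).trace.re ≤ 2 ^ R := by
  obtain ⟨K, hK, rfl⟩ : ∃ K : Op A, IsUnit K ∧ H = K.conjTranspose * K := by
    open scoped MatrixOrder in
    exact CStarAlgebra.isStrictlyPositive_iff_eq_star_mul_self.1 hH.isStrictlyPositive
  have hφ : star (fun p : A × A => K p.1 p.2) ⬝ᵥ (fun p : A × A => K p.1 p.2) = 1 := by
    rw [← hH1]
    simp only [dotProduct, Fintype.sum_prod_type, Matrix.trace, Matrix.diag, Matrix.mul_apply,
      Matrix.conjTranspose_apply, Pi.star_apply]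
    rw [Finset.sum_comm]
  have h1 : maxRainsRelEntropy (localConj K (choi N)) < R := by
    rw [← idTensor_vecMulVec_eq_localConj]
    exact (le_iSup₂ (f := fun (φ : A × A → ℂ) (_ : star φ ⬝ᵥ φ = 1) =>
      maxRainsRelEntropy (idTensor A N (Matrix.vecMulVec φ (star φ)))) _ hφ).trans_lt hR
  obtain ⟨P, Q, hP, hQ, hPQ, htr⟩ := exists_posSemidef_of_maxRainsRelEntropy_lt h1
  refine ⟨localConj K⁻¹ P, localConj K⁻¹ Q, hP.localConj _, hQ.localConj _, ?_, ?_⟩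
  · have := hPQ.localConj K⁻¹
    rwa [localConj_sub, localConj_inv_localConj hK, ← partialTranspose_localConj,
      localConj_sub] at this
  · rw [← localConj_add, partialTraceRight_localConj]
    have hdet := (Matrix.isUnit_iff_isUnit_det K).1 hK
    have h2 : K⁻¹.conjTranspose * K.conjTranspose = 1 := by
      rw [← Matrix.conjTranspose_mul, Matrix.mul_nonsing_inv _ hdet, Matrix.conjTranspose_one]
    have h3 : (K.conjTranspose * K * (K⁻¹ * partialTraceRight (P + Q) *
        K⁻¹.conjTranspose)).trace = (P + Q).trace := by
      rw [Matrix.mul_assoc, Matrix.trace_mul_comm, Matrix.mul_assoc K⁻¹,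
        Matrix.mul_nonsing_inv_cancel_left _ _ hdet, Matrix.mul_assoc, h2, Matrix.mul_one,
        trace_partialTraceRight]
    rw [h3]
    exact htr

theorem isChoiRainsBounded_of_maxRainsInformation_lt [Nonempty A] {N : Superop A B} {R w : ℝ}
    (hR : maxRainsInformation N < R) (hw : 2 ^ R < w) : IsChoiRainsBounded w N := by
  obtain ⟨X, ⟨Y, Z, hY, hZ, hYZ, rfl⟩, hX⟩ := exists_le_smul_one_of_forall_trace_mul_le
    (F := {X | ∃ Y Z : Op (A × B), Y.PosSemidef ∧ Z.PosSemidef ∧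
      (partialTranspose A B (Y - Z) - choi N).PosSemidef ∧ partialTraceRight (Y + Z) = X})
    (by
      rintro _ ⟨Y, Z, hY, hZ, hYZ, rfl⟩ _ ⟨Y', Z', hY', hZ', hYZ', rfl⟩ a b ha hb hab
      refine ⟨a • Y + b • Y', a • Z + b • Z', (hY.smul ha).add (hY'.smul hb),
        (hZ.smul ha).add (hZ'.smul hb), ?_, ?_⟩
      · convert (hYZ.smul ha).add (hYZ'.smul hb) using 1
        have h1 : a • Y + b • Y' - (a • Z + b • Z') = a • (Y - Z) + b • (Y' - Z') := by module
        have h2 : a • choi N + b • choi N = choi N := by rw [← add_smul, hab, one_smul]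
        have h3 (c : ℝ) (V : Op (A × B)) :
            partialTranspose A B (c • V) = c • partialTranspose A B V := rfl
        rw [h1, map_add, h3, h3, smul_sub, smul_sub, sub_add_sub_comm, h2]
      · rw [← partialTraceRight_smul, ← partialTraceRight_smul, ← partialTraceRight_add]
        congr 1
        module)
    (by
      rintro _ ⟨Y, Z, hY, hZ, -, rfl⟩
      exact partialTraceRight_posSemidef (hY.add hZ))
    (by positivity) hw
    (fun H hH hH1 => by
      obtain ⟨Y, Z, hY, hZ, hYZ, h⟩ := exists_trace_mul_le_of_maxRainsInformation_lt hR hH hH1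
      exact ⟨_, ⟨Y, Z, hY, hZ, hYZ, rfl⟩, h⟩)
  exact ⟨Y, Z, hY, hZ, hYZ, hX⟩

end

/-! ### LOCC channels are PPT-preserving -/

theorem idTensor_sum {R A B : Type} {ι : Type} (s : Finset ι) (Φ : ι → Superop A B)
    (X : Op (R × A)) : idTensor R (∑ i ∈ s, Φ i) X = ∑ i ∈ s, idTensor R (Φ i) X := by
  ext p q
  simp [idTensor_apply, Matrix.sum_apply, LinearMap.sum_apply]

theorem IsCompletelyPositive.comp {A B C : Type} {Ψ : Superop B C} {Φ : Superop A B}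
    (hΨ : IsCompletelyPositive Ψ) (hΦ : IsCompletelyPositive Φ) :
    IsCompletelyPositive (Ψ ∘ₗ Φ) :=
  fun k X hX => hΨ k _ (hΦ k X hX)

theorem IsCompletelyPositive.sum {A B ι : Type} {s : Finset ι} {Φ : ι → Superop A B}
    (h : ∀ i ∈ s, IsCompletelyPositive (Φ i)) : IsCompletelyPositive (∑ i ∈ s, Φ i) := by
  intro k X hX
  rw [idTensor_sum]
  exact Matrix.posSemidef_sum s fun i hi => h i hi k X hX

theorem IsCompletelyPositive.tensorMap {A B A' B' : Type} [Fintype A] [Fintype B']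
    {F : Superop A A'} {G : Superop B B'} (hF : IsCompletelyPositive F)
    (hG : IsCompletelyPositive G) : IsCompletelyPositive (tensorMap F G) := by
  intro k X hX
  have h1 := hG.idTensor_posSemidef (R := Fin k × A)
    (hX.submatrix fun p : (Fin k × A) × B => (p.1.1, (p.1.2, p.2)))
  have h2 := hF.idTensor_posSemidef (R := Fin k × B')
    (h1.submatrix fun p : (Fin k × B') × A => ((p.1.1, p.2), p.1.2))
  exact h2.submatrix fun p : Fin k × (A' × B') => ((p.1, p.2.2), p.2.1)

/-- The conjugate `T ∘ Φ ∘ T` of a linear map by the transposes. -/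
def transposeConj {A B : Type} (Φ : Superop A B) : Superop A B where
  toFun X := (Φ X.transpose).transpose
  map_add' X Y := by simp
  map_smul' c X := by simp

theorem transposeConj_sum {A B ι : Type} (s : Finset ι) (Φ : ι → Superop A B) :
    transposeConj (∑ i ∈ s, Φ i) = ∑ i ∈ s, transposeConj (Φ i) := by
  ext X b b'
  simp [transposeConj, LinearMap.sum_apply, Matrix.sum_apply]

/-- The full transpose preserves positivity, and `id ⊗ (T ∘ Φ ∘ T)` is the conjugate of `id ⊗ Φ` by
full transposes. -/
theorem IsCompletelyPositive.transposeConj {A B : Type} {Φ : Superop A B}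
    (hΦ : IsCompletelyPositive Φ) : IsCompletelyPositive (transposeConj Φ) :=
  fun k X hX => (hΦ k X.transpose hX.transpose).transpose

theorem IsChannel.transposeConj {A B : Type} [Fintype A] [Fintype B] {Φ : Superop A B}
    (hΦ : IsChannel Φ) : IsChannel (transposeConj Φ) :=
  ⟨hΦ.1.transposeConj, fun X => by
    change (Φ X.transpose).transpose.trace = _
    rw [Matrix.trace_transpose, hΦ.2, Matrix.trace_transpose]⟩

theorem partialTranspose_tensorMap {A B A' B' : Type} (F : Superop A A') (G : Superop B B') :
    partialTranspose A' B' ∘ₗ tensorMap F G ∘ₗ partialTranspose A B =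
      tensorMap F (transposeConj G) := rfl

theorem partialTranspose_sum_tensorMap {A B A' B' : Type} {m : ℕ} (F : Fin m → Superop A A')
    (G : Fin m → Superop B B') :
    partialTranspose A' B' ∘ₗ (∑ x, tensorMap (F x) (G x)) ∘ₗ partialTranspose A B =
      ∑ x, tensorMap (F x) (transposeConj (G x)) := by
  simp only [← partialTranspose_tensorMap]
  ext X p q
  simp [LinearMap.sum_apply, map_sum, Matrix.sum_apply]

theorem IsChannel.comp {A B C : Type} [Fintype A] [Fintype B] [Fintype C] {Ψ : Superop B C}
    {Φ : Superop A B} (hΨ : IsChannel Ψ) (hΦ : IsChannel Φ) : IsChannel (Ψ ∘ₗ Φ) :=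
  ⟨hΨ.1.comp hΦ.1, fun X => (hΨ.2 _).trans (hΦ.2 X)⟩

/-- The partial trace over the first system. -/
def partialTraceLeft {A B : Type} [Fintype A] (X : Op (A × B)) : Op B :=
  Matrix.of fun b b' => ∑ a, X (a, b) (a, b')

theorem trace_partialTraceLeft {A B : Type} [Fintype A] [Fintype B] (X : Op (A × B)) :
    (partialTraceLeft X).trace = X.trace := by
  simp [partialTraceLeft, Matrix.trace, Fintype.sum_prod_type_right]

theorem trace_tensorId {A A' B : Type} [Fintype A] [Fintype A'] [Fintype B] (F : Superop A A')
    (X : Op (A × B)) : (tensorId B F X).trace = (F (partialTraceRight X)).trace := by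
  have : partialTraceRight X = ∑ b, Matrix.of fun a a' => X (a, b) (a', b) := by
    ext a a'; simp [partialTraceRight, Matrix.sum_apply]
  rw [this, map_sum, Matrix.trace_sum]
  simp [Matrix.trace, Fintype.sum_prod_type_right, tensorId_apply]

theorem trace_idTensor {A B B' : Type} [Fintype A] [Fintype B] [Fintype B'] (G : Superop B B')
    (X : Op (A × B)) : (idTensor A G X).trace = (G (partialTraceLeft X)).trace := by
  have : partialTraceLeft X = ∑ a, Matrix.of fun b b' => X (a, b) (a, b') := by
    ext a a'; simp [partialTraceLeft, Matrix.sum_apply]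
  rw [this, map_sum, Matrix.trace_sum]
  simp [Matrix.trace, Fintype.sum_prod_type, idTensor_apply]

theorem isChannel_sum_tensorMap_left {A B A' B' : Type} [Fintype A] [Fintype B] [Fintype A']
    [Fintype B'] {m : ℕ} {F : Fin m → Superop A A'} {G : Fin m → Superop B B'}
    (hF : ∀ x, IsCompletelyPositive (F x)) (hFsum : IsChannel (∑ x, F x))
    (hG : ∀ x, IsChannel (G x)) : IsChannel (∑ x, tensorMap (F x) (G x)) := by
  refine ⟨.sum fun x _ => (hF x).tensorMap (hG x).1, fun X => ?_⟩
  have h (x : Fin m) : partialTraceRight (idTensor A (G x) X) = partialTraceRight X := by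
    ext a a'
    exact (hG x).2 (Matrix.of fun b b' => X (a, b) (a', b'))
  simp only [LinearMap.sum_apply, Matrix.trace_sum, tensorMap, LinearMap.comp_apply,
    trace_tensorId, h]
  rw [← Matrix.trace_sum, ← LinearMap.sum_apply, hFsum.2, trace_partialTraceRight]

theorem isChannel_sum_tensorMap_right {A B A' B' : Type} [Fintype A] [Fintype B] [Fintype A']
    [Fintype B'] {m : ℕ} {F : Fin m → Superop A A'} {G : Fin m → Superop B B'}
    (hF : ∀ x, IsChannel (F x)) (hG : ∀ x, IsCompletelyPositive (G x))
    (hGsum : IsChannel (∑ x, G x)) : IsChannel (∑ x, tensorMap (F x) (G x)) := by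
  refine ⟨.sum fun x _ => (hF x).1.tensorMap (hG x), fun X => ?_⟩
  simp only [LinearMap.sum_apply, Matrix.trace_sum, tensorMap, LinearMap.comp_apply,
    trace_tensorId, (hF _).2, trace_partialTraceRight, trace_idTensor]
  rw [← Matrix.trace_sum, ← LinearMap.sum_apply, hGsum.2, trace_partialTraceLeft]

/-- Conjugation by the partial transposes only turns each `G x` into `T ∘ G x ∘ T`, which keeps the
one-way form; in a composition the two inner transposes cancel. -/
theorem IsLOCC.isPPTPreserving {A B A' B' : Type} [Fintype A] [Fintype B] [Fintype A']
    [Fintype B'] {P : Superop (A × B) (A' × B')} (hP : IsLOCC A B A' B' P) :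
    IsPPTPreserving A B A' B' P := by
  induction hP with
  | aliceToBob m F G hF hFsum hG =>
    refine ⟨isChannel_sum_tensorMap_left hF hFsum hG, ?_⟩
    rw [partialTranspose_sum_tensorMap]
    exact isChannel_sum_tensorMap_left hF hFsum fun x => (hG x).transposeConj
  | bobToAlice m F G hF hG hGsum =>
    refine ⟨isChannel_sum_tensorMap_right hF hG hGsum, ?_⟩
    rw [partialTranspose_sum_tensorMap]
    refine isChannel_sum_tensorMap_right hF (fun x => (hG x).transposeConj) ?_
    rw [← transposeConj_sum]
    exact hGsum.transposeConj
  | comp P Q _ _ ihP ihQ =>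
    refine ⟨ihQ.1.comp ihP.1, ?_⟩
    convert ihQ.2.comp ihP.2 using 1
    ext1 X
    simp only [LinearMap.comp_apply, partialTranspose_partialTranspose]

theorem HasProtocol.isPPTPreserving {A B : Type} [Fintype A] [Fintype B] {N : Superop A B}
    {n M : ℕ} {ε : ℝ} (h : HasProtocol IsLOCC N n M ε) :
    HasProtocol IsPPTPreserving N n M ε := by
  obtain ⟨a, b, σ, P, hσ, hP, hε⟩ := h
  refine ⟨a, b, σ, P, ?_, hP.isPPTPreserving, hε⟩
  clear hP hε P
  induction hσ with
  | first a b P hP => exact .first a b P hP.isPPTPreserving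
  | next n a b a' b' σ _ P hP ih => exact .next n a b a' b' σ ih P hP.isPPTPreserving

/-! ### Capacities -/

theorem isStrongConverseRate_of_maxRainsInformation_lt {A B : Type} [Fintype A] [DecidableEq A]
    [Nonempty A] [Fintype B] [DecidableEq B] {N : Superop A B} (hN : IsChannel N) {R : ℝ}
    (hR : maxRainsInformation N < R) : IsStrongConverseRate IsPPTPreserving N R := by
  intro ε hε δ hδ
  -- Half of `δ` pays for the strict inequality `w > 2 ^ R`; the other half leaves the decaying
  -- bound `2 ^ (-n δ / 2)` on the fidelity.
  have hlt : (2 : ℝ) ^ R < 2 ^ (R + δ / 2) :=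
    Real.rpow_lt_rpow_of_exponent_lt one_lt_two (by linarith)
  have hNw := isChoiRainsBounded_of_maxRainsInformation_lt hR hlt
  have hlim : Filter.Tendsto (fun n : ℕ => ((2 : ℝ) ^ (-(δ / 2))) ^ n) Filter.atTop (nhds 0) :=
    tendsto_pow_atTop_nhds_zero_of_lt_one (by positivity)
      (Real.rpow_lt_one_of_one_lt_of_neg one_lt_two (by linarith))
  filter_upwards [hlim.eventually_lt_const (sub_pos.2 hε.2)] with n hn
  rintro ⟨M, hM, hprot⟩
  have h1 := hprot.one_sub_le hN.1 (by positivity) hNw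
  have h2 : ((2 : ℝ) ^ (R + δ / 2)) ^ n / M ≤ ((2 : ℝ) ^ (-(δ / 2))) ^ n := by
    have hM0 : (0 : ℝ) < M := lt_of_lt_of_le (by positivity) hM
    rw [div_le_iff₀ hM0]
    calc ((2 : ℝ) ^ (R + δ / 2)) ^ n = ((2 : ℝ) ^ (-(δ / 2))) ^ n * 2 ^ ((n : ℝ) * (R + δ)) := by
          rw [← Real.rpow_mul_natCast zero_le_two, ← Real.rpow_mul_natCast zero_le_two,
            ← Real.rpow_add two_pos]
          congr 1
          ring
      _ ≤ _ := mul_le_mul_of_nonneg_left hM (by positivity)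
  linarith

theorem IsStrongConverseRate.of_isPPTPreserving {A B : Type} [Fintype A] [Fintype B]
    {N : Superop A B} {R : ℝ} (h : IsStrongConverseRate IsPPTPreserving N R) :
    IsStrongConverseRate IsLOCC N R := by
  intro ε hε δ hδ
  filter_upwards [h ε hε δ hδ] with n hn
  rintro ⟨M, hM, hprot⟩
  exact hn ⟨M, hM, hprot.isPPTPreserving⟩

theorem IsAchievableRate.le_of_isStrongConverseRate {free : FreeClass} {A B : Type} [Fintype A]
    [Fintype B] {N : Superop A B} {R R' : ℝ} (h : IsAchievableRate free N R)
    (h' : IsStrongConverseRate free N R') : R ≤ R' := by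
  by_contra! hlt
  -- With `δ` half the gap, both conditions on `M` have the same threshold, at the midpoint of `R'`
  -- and `R`; `ε = 1 / 2` is allowed in both definitions.
  obtain ⟨n, ⟨M, hM, hprot⟩, hn⟩ :=
    ((h (1 / 2) ⟨by norm_num, by norm_num⟩ ((R - R') / 2) (by linarith)).and
      (h' (1 / 2) ⟨by norm_num, by norm_num⟩ ((R - R') / 2) (by linarith))).exists
  refine hn ⟨M, ?_, hprot⟩
  rwa [show R' + (R - R') / 2 = R - (R - R') / 2 by ring]

theorem assistedCapacity_le_strongConverseCapacity (free : FreeClass) {A B : Type} [Fintype A]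
    [Fintype B] (N : Superop A B) :
    assistedCapacity free N ≤ strongConverseCapacity free N :=
  iSup₂_le fun _ hR => le_iInf₂ fun _ hR' =>
    EReal.coe_le_coe_iff.2 (hR.le_of_isStrongConverseRate hR')

theorem strongConverseCapacity_isLOCC_le {A B : Type} [Fintype A] [Fintype B]
    (N : Superop A B) :
    strongConverseCapacity IsLOCC N ≤ strongConverseCapacity IsPPTPreserving N :=
  le_iInf₂ fun R hR => iInf₂_le R hR.of_isPPTPreserving

end

theorem mainTheorem4 {A B : Type} [Fintype A] [DecidableEq A] [Nonempty A]
    [Fintype B] [DecidableEq B] (N : Superop A B) (hN : IsChannel N) :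
    strongConverseCapacity IsPPTPreserving N ≤ maxRainsInformation N ∧
      strongConverseCapacity IsLOCC N ≤ maxRainsInformation N ∧
      assistedCapacity IsLOCC N ≤ maxRainsInformation N := by
  have h : strongConverseCapacity IsPPTPreserving N ≤ maxRainsInformation N := by
    refine EReal.le_of_forall_lt_iff_le.1 fun R hR => ?_
    exact iInf₂_le R (isStrongConverseRate_of_maxRainsInformation_lt hN hR)
  have h' := (strongConverseCapacity_isLOCC_le N).trans h
  exact ⟨h, h', (assistedCapacity_le_strongConverseCapacity _ N).trans h'⟩
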